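/- Let $\lambda\in\mathbb C$ with $\operatorname{Re}\lambda>0$ and $\operatorname{Im}\lambda>0$, let $k\ge 1$ be an integer, and put $Q(z)=\lambda(z-1)^kz$, $P(z)=(z-1)^k$, $R=Q/P$ (so $R(z)=\lambda z$) and $T=Q\,\frac{d}{dz}+P$. A nonempty closed set $S\subset\mathbb C$ is called $T_{CH}$-invariant if for all $u\in S$ and all real $t\ge 0$ the function $T((z-u)^t)$ either vanishes identically or has all its roots in $S$. Let $M$ be the intersection of all $T_{CH}$-invariant sets. For $x\in\partial M$ with $PQ(x)\ne0$, let $\Gamma(x)$ be the set of points $y\neq x$ of the positive trajectory of the vector field $R(z)\partial_z$ starting at $x$ that lie in $\overline M$, and let $\Delta(x)$ be the set of points $y\ne x$ of $\overline{r(x)}\cap\overline M$, where $r(x)=\{x+tR(x): t\ge 0\}$; closures are taken in the compactification $\mathbb C\cup\mathbb S^1$ of the plane by the circle of directions at infinity. A point of $\partial M$ that is neither a root of $PQ$ nor in the closure of $\{\operatorname{Im}R'=0\}$ is of local type if $\Gamma\neq\emptyset=\Delta$, of global type if $\Gamma=\emptyset\ne\Delta$, and of extruding type if $\Gamma\ne\emptyset\neq\Delta$.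 A local arc is a maximal open arc of an integral curve of $R(z)\partial_z$ that contains only points of local type; a global arc is a maximal open arc formed by points of global type (an open arc being a set homeomorphic to an open interval). Put $\gamma(t)=e^{-\lambda t}$ and $\alpha(t)=\frac1{1+\lambda t}$. Then $M$ is itself $T_{CH}$-invariant (so it is the unique minimal $T_{CH}$-invariant set), it is compact, and there are $t_0,t_1>0$ such that * $\gamma(t_0)=\alpha(t_1)$ is the first intersection point of $\gamma$ and $\alpha$ on $\mathbb R_{>0}$: whenever $s,t>0$ and $\gamma(s)=\alpha(t)$, one has $s\ge t_0$ and $t\ge t_1$; * $\partial M=\gamma([0,t_0])\cup\alpha([0,t_1])$; * $\gamma(]0,t_0[)$ is a local arc and $\alpha(]0,t_1[)$ is a global arc of $\partial M$; * $\gamma([0,t_0])\cap\alpha([0,t_1])=\{1,\gamma(t_0)\}$, and $\gamma(t_0)$ is a point of extruding type. -/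

import Mathlib

open Polynomial Set

noncomputable section

namespace Hutchinson

/-! ### Invariant sets of `T = Q d/dz + P` acting on the functions `(z - u) ^ t` -/

/-- `L` is a holomorphic branch of `log (z - u)` on the open set `U`. -/
def IsLogBranch (u : ℂ) (U : Set ℂ) (L : ℂ → ℂ) : Prop :=
  IsOpen U ∧ DifferentiableOn ℂ L U ∧ ∀ z ∈ U, Complex.exp (L z) = z - u

/-- The branch of `(z - u) ^ t` that belongs to the branch `L` of `log (z - u)`. -/
def powBranch (t : ℝ) (L : ℂ → ℂ) : ℂ → ℂ := fun z => Complex.exp (t * L z)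

/-- The operator `T = Q d/dz + P`. -/
def diffOp (Q P : ℂ[X]) (f : ℂ → ℂ) : ℂ → ℂ := fun z => Q.eval z * deriv f z + P.eval z * f z

/-- `z` is a root of `T ((z - u) ^ t)`. The function `(z - u) ^ t` is multivalued; two of its local
branches differ by a nonzero constant factor, so the choice of the branch is immaterial. Only
points `z ≠ u` matter below, because `u` itself belongs to the set under consideration. -/
def IsRootOfImage (Q P : ℂ[X]) (u : ℂ) (t : ℝ) (z : ℂ) : Prop :=
  ∃ U L, IsLogBranch u U L ∧ z ∈ U ∧ diffOp Q P (powBranch t L) z = 0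

/-- `T ((z - u) ^ t)` vanishes identically. -/
def ImageVanishes (Q P : ℂ[X]) (u : ℂ) (t : ℝ) : Prop :=
  ∀ U L, IsLogBranch u U L → ∀ z ∈ U, diffOp Q P (powBranch t L) z = 0

/-- Continuously Hutchinson invariant (nonempty, closed) subsets of the plane. -/
structure IsTCHInvariant (Q P : ℂ[X]) (S : Set ℂ) : Prop where
  nonempty : S.Nonempty
  isClosed : IsClosed S
  roots_mem : ∀ u ∈ S, ∀ t : ℝ, 0 ≤ t →
    ImageVanishes Q P u t ∨ ∀ z, IsRootOfImage Q P u t z → z ∈ S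

/-- The minimal continuously Hutchinson invariant set: the intersection of all of them. -/
def minimalSet (Q P : ℂ[X]) : Set ℂ := ⋂₀ {S | IsTCHInvariant Q P S}

/-! ### The vector field `R(z) ∂_z`, `R = Q / P` -/

/-- The rational function `R = Q / P`. -/
def ratio (Q P : ℂ[X]) : RatFunc ℂ := algebraMap ℂ[X] (RatFunc ℂ) Q / algebraMap ℂ[X] (RatFunc ℂ) P

/-- The value of the rational function `R = Q / P` (in lowest terms); meaningful away from poles. -/
def field (Q P : ℂ[X]) (z : ℂ) : ℂ := (ratio Q P).eval (RingHom.id ℂ) z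

/-- The poles of `R`. -/
def poles (Q P : ℂ[X]) : Set ℂ := {z | (ratio Q P).denom.eval z = 0}

/-- The roots of `P` and `Q`. -/
def zeroSet (Q P : ℂ[X]) : Set ℂ := {z | P.eval z = 0 ∨ Q.eval z = 0}

/-- The curve of inflections: the closure of `{Im R' = 0}`. -/
def inflectionCurve (Q P : ℂ[X]) : Set ℂ :=
  closure {z | z ∉ poles Q P ∧ (deriv (field Q P) z).im = 0}

/-- `c` is an integral curve of `R(z) ∂_z` on the interval `I`. -/
def IsFieldCurve (Q P : ℂ[X]) (c : ℝ → ℂ) (I : Set ℝ) : Prop :=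
  (∀ s ∈ I, c s ∉ poles Q P) ∧ IsIntegralCurveOn c (fun _ z => field Q P z) I

/-- The positive trajectory of `R(z) ∂_z` starting at `x`. -/
def positiveTrajectory (Q P : ℂ[X]) (x : ℂ) : Set ℂ :=
  {y | ∃ (τ : ℝ) (c : ℝ → ℂ), 0 ≤ τ ∧ IsFieldCurve Q P c (Icc 0 τ) ∧ c 0 = x ∧ c τ = y}

/-- The associated ray at `x` (used where `P` and `Q` do not vanish). -/
def ray (Q P : ℂ[X]) (x : ℂ) : Set ℂ := {y | ∃ t : ℝ, 0 ≤ t ∧ y = x + t * (Q.eval x / P.eval x)}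

/-! ### The extended plane `ℂ ∪ S¹` -/

/-- The plane with a circle of directions added at infinity. -/
inductive ExtendedPlane where
  | point (z : ℂ)
  | direction (θ : Circle)

open ExtendedPlane

/-- The open cone with apex `a` and set of directions `I`. -/
def cone (a : ℂ) (I : Set Circle) : Set ℂ := {z | ∃ r : ℝ, 0 < r ∧ ∃ θ ∈ I, z = a + r * (θ : ℂ)}

/-- The topology generated by the open subsets of `ℂ` and by the sets `I ∪ C(a, I)`, where `I` is an
open subset of the circle and `C(a, I)` is the cone with apex `a` over `I`. -/
instance : TopologicalSpace ExtendedPlane :=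
  TopologicalSpace.generateFrom
    ({V | ∃ U : Set ℂ, IsOpen U ∧ V = point '' U} ∪
      {V | ∃ (a : ℂ) (I : Set Circle), IsOpen I ∧ V = direction '' I ∪ point '' cone a I})

/-- The closure in the extended plane of a subset of `ℂ`. -/
def extClosure (S : Set ℂ) : Set ExtendedPlane := closure (point '' S)

/-! ### The correspondences `Γ`, `Δ` and the types of boundary points -/

/-- `Γ(x)`. -/
def Gam (Q P : ℂ[X]) (x : ℂ) : Set ExtendedPlane :=
  (point '' positiveTrajectory Q P x \ {point x}) ∩ extClosure (minimalSet Q P)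

/-- `Δ(x)`. -/
def Del (Q P : ℂ[X]) (x : ℂ) : Set ExtendedPlane :=
  (extClosure (ray Q P x) \ {point x}) ∩ extClosure (minimalSet Q P)

/-- The boundary points that are neither roots of `P` or `Q` nor on the curve of inflections. -/
def ordinaryBoundary (Q P : ℂ[X]) : Set ℂ :=
  frontier (minimalSet Q P) \ (zeroSet Q P ∪ inflectionCurve Q P)

/-- The points of local type. -/
def localPoints (Q P : ℂ[X]) : Set ℂ :=
  {z ∈ ordinaryBoundary Q P | (Gam Q P z).Nonempty ∧ Del Q P z = ∅}

/-- The points of global type. -/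
def globalPoints (Q P : ℂ[X]) : Set ℂ :=
  {z ∈ ordinaryBoundary Q P | Gam Q P z = ∅ ∧ (Del Q P z).Nonempty}

/-- The points of extruding type. -/
def extrudingPoints (Q P : ℂ[X]) : Set ℂ :=
  {z ∈ ordinaryBoundary Q P | (Gam Q P z).Nonempty ∧ (Del Q P z).Nonempty}

/-- `A` is an open arc of an integral curve of `R(z) ∂_z`. -/
def IsIntegralArc (Q P : ℂ[X]) (A : Set ℂ) : Prop :=
  ∃ (I : Set ℝ) (c : ℝ → ℂ), IsOpen I ∧ I.OrdConnected ∧ I.Nonempty ∧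
    IsFieldCurve Q P c I ∧ A = c '' I

/-- A local arc: a maximal open arc of an integral curve that contains only local points. -/
def IsLocalArc (Q P : ℂ[X]) (A : Set ℂ) : Prop :=
  Maximal (fun B => IsIntegralArc Q P B ∧ B ⊆ localPoints Q P) A

/-- `A` is an open arc: it is homeomorphic to an open interval. -/
def IsOpenArc (A : Set ℂ) : Prop := Nonempty (A ≃ₜ Ioo (0 : ℝ) 1)

/-- A global arc: a maximal open arc formed by points of global type. -/
def IsGlobalArc (Q P : ℂ[X]) (A : Set ℂ) : Prop :=
  Maximal (fun B => IsOpenArc B ∧ B ⊆ globalPoints Q P) A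

end Hutchinson

end

/-! Away from the factor (z - 1)^k, the roots of T((z - u)^t) are the solutions of z(1 + λt) = u.
Hence a set is invariant exactly when it is closed, contains 1 and is stable under multiplication by
every α(t) (`isTCHInvariant_iff`), and M is the smallest such set.

Write z = exp(-(X + iY)). Multiplication becomes addition of (X, Y), the spiral γ becomes the line Y
= slope · X, and the circular arc α becomes the graph of `lower`. Their difference `gap` is convex
on X ≥ 0, with value and derivative 0 at 0, so it is superadditive (`gap_add_le`). Therefore the
band lower X ≤ Y ≤ slope · X is an additive semigroup containing α. Conversely, γ(s) is the limit of
α(s/n)^n, and every point of the band is a point of α plus a point of γ. Thus M is the image of the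
band together with 0 (`minimalSet_eq`).

At the radius X₀ with gap X₀ = 2π the band wraps once around the origin, and from there on it fills
a disc. Its edges up to X₀ are the boundary, and they meet again first at X₀.

For the types: the flow of R translates by -(D, slope · D), and the associated ray by -(B, lower B).
From an edge point other than 1, the flow (on the spiral) or the ray (on the circle) leads back to
1. Before X₀ the other motion leaves the band, and it cannot re-enter modulo 2π because gap < 2π
there. -/

namespace Hutchinson.Spiral

noncomputable section

/-! ### Convexity and growth of the gap between spiral and circle -/

/-- The slope of the logarithmic spiral `exp (-λ s)` in logarithmic coordinates. -/
def slope (lam : ℂ) : ℝ := lam.im / lam.re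

/-- The sine of the argument of `λ`. -/
def sine (lam : ℂ) : ℝ := lam.im / ‖lam‖

/-- The circle `1 / (1 + λ t)` is the curve `exp (-(X + i lower X))`. -/
def lower (lam : ℂ) (X : ℝ) : ℝ :=
  Real.arcsin (sine lam) - Real.arcsin (sine lam * Real.exp (-X))

/-- The angle between the circle and the spiral at the radius `exp (-X)`. -/
def gap (lam : ℂ) (X : ℝ) : ℝ := slope lam * X - lower lam X

/-- The derivative of `gap`. -/
def gapDeriv (lam : ℂ) (X : ℝ) : ℝ :=
  slope lam - sine lam * Real.exp (-X) / √(1 - (sine lam * Real.exp (-X)) ^ 2)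

variable {lam : ℂ}

lemma norm_pos_of_re (hre : 0 < lam.re) : 0 < ‖lam‖ :=
  norm_pos_iff.2 fun h => by simp [h] at hre

lemma sine_pos (hre : 0 < lam.re) (him : 0 < lam.im) : 0 < sine lam :=
  div_pos him (norm_pos_of_re hre)

lemma sq_norm_eq (lam : ℂ) : ‖lam‖ ^ 2 = lam.re ^ 2 + lam.im ^ 2 := by
  rw [Complex.sq_norm, Complex.normSq_apply]; ring

lemma sqrt_one_sub_sine_sq (hre : 0 < lam.re) : √(1 - sine lam ^ 2) = lam.re / ‖lam‖ := by
  have hn := norm_pos_of_re hre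
  have h : 1 - sine lam ^ 2 = (lam.re / ‖lam‖) ^ 2 := by
    have := sq_norm_eq lam
    unfold sine
    field_simp
    linarith
  rw [h, Real.sqrt_sq (by positivity)]

lemma sine_lt_one (hre : 0 < lam.re) : sine lam < 1 := by
  have hn := norm_pos_of_re hre
  rw [sine, div_lt_one hn]
  refine lt_of_pow_lt_pow_left₀ 2 hn.le ?_
  rw [sq_norm_eq]
  have := pow_pos hre 2
  linarith

lemma lower_zero : lower lam 0 = 0 := by simp [lower]

lemma gap_zero : gap lam 0 = 0 := by simp [gap, lower_zero]

lemma continuous_lower : Continuous (lower lam) := by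
  unfold lower
  have := Real.continuous_arcsin
  fun_prop

lemma continuous_gap : Continuous (gap lam) := by
  have := continuous_lower (lam := lam)
  unfold gap
  fun_prop

lemma sine_mul_exp_lt_one (hre : 0 < lam.re) (him : 0 < lam.im) {X : ℝ} (hX : 0 ≤ X) :
    sine lam * Real.exp (-X) < 1 := by
  have h1 : Real.exp (-X) ≤ 1 := Real.exp_le_one_iff.2 (by linarith)
  nlinarith [sine_pos hre him, sine_lt_one hre]

lemma hasDerivAt_gap (hre : 0 < lam.re) (him : 0 < lam.im) {X : ℝ} (hX : 0 ≤ X) :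
    HasDerivAt (gap lam) (gapDeriv lam X) X := by
  have hs := sine_pos hre him
  have h1 := sine_mul_exp_lt_one hre him hX
  have h0 : 0 < sine lam * Real.exp (-X) := by positivity
  have he : HasDerivAt (fun x => sine lam * Real.exp (-x)) (sine lam * (Real.exp (-X) * -1)) X :=
    ((hasDerivAt_neg X).exp).const_mul _
  have ha := (Real.hasDerivAt_arcsin (by linarith) h1.ne).comp X he
  have := ((hasDerivAt_id X).const_mul (slope lam)).sub
    (ha.const_sub (Real.arcsin (sine lam)))
  refine this.congr_deriv ?_
  unfold gapDeriv
  ring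

/-- The spiral and the circle are tangent at 1: both start in the direction -λ. -/
lemma gapDeriv_zero (hre : 0 < lam.re) : gapDeriv lam 0 = 0 := by
  have hn := norm_pos_of_re hre
  simp only [gapDeriv, neg_zero, Real.exp_zero, mul_one, sqrt_one_sub_sine_sq hre]
  unfold slope sine
  field_simp
  ring

/-- p / √(1 - p²) increases with p, while p = sine · exp(-X) decreases with X. This is the strict
convexity of `gap`. -/
lemma strictMonoOn_gapDeriv (hre : 0 < lam.re) (him : 0 < lam.im) :
    StrictMonoOn (gapDeriv lam) (Ici 0) := by
  intro a ha b hb hab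
  have hs := sine_pos hre him
  have hlt : sine lam * Real.exp (-b) < sine lam * Real.exp (-a) := by gcongr
  have h1 := sine_mul_exp_lt_one hre him ha
  have h0 : 0 < sine lam * Real.exp (-b) := by positivity
  unfold gapDeriv
  set p := sine lam * Real.exp (-a)
  set q := sine lam * Real.exp (-b)
  have hpos : 0 < 1 - p ^ 2 := by nlinarith
  have hsq : √(1 - p ^ 2) ≤ √(1 - q ^ 2) := Real.sqrt_le_sqrt (by nlinarith)
  have : q / √(1 - q ^ 2) < p / √(1 - p ^ 2) :=
    div_lt_div₀ hlt hsq (by linarith) (Real.sqrt_pos.2 hpos)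
  linarith

lemma strictMonoOn_gap (hre : 0 < lam.re) (him : 0 < lam.im) :
    StrictMonoOn (gap lam) (Ici 0) := by
  refine strictMonoOn_of_deriv_pos (convex_Ici 0) continuous_gap.continuousOn fun x hx => ?_
  rw [interior_Ici] at hx
  have hx : 0 < x := hx
  rw [(hasDerivAt_gap hre him hx.le).deriv, ← gapDeriv_zero hre]
  exact strictMonoOn_gapDeriv hre him self_mem_Ici hx.le hx

lemma gap_pos (hre : 0 < lam.re) (him : 0 < lam.im) {X : ℝ} (hX : 0 < X) : 0 < gap lam X := by
  simpa [gap_zero] using strictMonoOn_gap hre him self_mem_Ici hX.le hX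

lemma gap_nonneg (hre : 0 < lam.re) (him : 0 < lam.im) {X : ℝ} (hX : 0 ≤ X) : 0 ≤ gap lam X := by
  simpa [gap_zero] using (strictMonoOn_gap hre him).monotoneOn self_mem_Ici hX hX

/-- A convex function vanishing at 0 is superadditive: the increment over a step b does not decrease
as its base point moves from 0 to a. -/
lemma gap_add_le (hre : 0 < lam.re) (him : 0 < lam.im) {a b : ℝ} (ha : 0 ≤ a) (hb : 0 ≤ b) :
    gap lam a + gap lam b ≤ gap lam (a + b) := by
  have hd : ∀ x, 0 ≤ x → HasDerivAt (fun x => gap lam (x + b) - gap lam x)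
      (gapDeriv lam (x + b) - gapDeriv lam x) x := fun x hx =>
    ((hasDerivAt_gap hre him (add_nonneg hx hb)).comp_add_const x b).sub
      (hasDerivAt_gap hre him hx)
  have hm : MonotoneOn (fun x => gap lam (x + b) - gap lam x) (Ici 0) := by
    refine monotoneOn_of_deriv_nonneg (convex_Ici 0)
      (fun x hx => (hd x hx).continuousAt.continuousWithinAt)
      (fun x hx => (hd x (interior_subset hx)).differentiableAt.differentiableWithinAt)
      fun x hx => ?_
    have hx : 0 ≤ x := interior_subset hx
    rw [(hd x hx).deriv]
    exact sub_nonneg.2 ((strictMonoOn_gapDeriv hre him).monotoneOn hx (add_nonneg hx hb)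
      (by linarith))
  have := hm self_mem_Ici ha ha
  simp only [zero_add, gap_zero] at this
  linarith

lemma exists_gap_eq_two_pi (hre : 0 < lam.re) (him : 0 < lam.im) :
    ∃ X, 0 < X ∧ gap lam X = 2 * Real.pi := by
  have hm : 0 < slope lam := div_pos him hre
  have hp := Real.pi_pos
  -- `lower` never exceeds π, so slope · C = 3π forces gap C ≥ 2π.
  set C := 3 * Real.pi / slope lam
  have hC : 0 < C := by positivity
  have hge : 2 * Real.pi ≤ gap lam C := by
    have h1 := Real.arcsin_le_pi_div_two (sine lam)
    have h2 := Real.neg_pi_div_two_le_arcsin (sine lam * Real.exp (-C))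
    have h3 : slope lam * C = 3 * Real.pi := by simp only [C]; field_simp
    unfold gap lower
    linarith
  obtain ⟨X, hX, hg⟩ := intermediate_value_Icc hC.le (continuous_gap (lam := lam)).continuousOn
    (show 2 * Real.pi ∈ Icc (gap lam 0) (gap lam C) from ⟨by rw [gap_zero]; positivity, hge⟩)
  refine ⟨X, lt_of_le_of_ne hX.1 ?_, hg⟩
  rintro rfl
  rw [gap_zero] at hg
  linarith

/-! ### Logarithmic coordinates for the circle and the spiral -/

/-- The point of modulus `exp (-X)` and argument `-Y`. -/
def polar (X Y : ℝ) : ℂ := Complex.exp (-(X + Y * Complex.I))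

lemma polar_mul (X Y X' Y' : ℝ) : polar X Y * polar X' Y' = polar (X + X') (Y + Y') := by
  rw [polar, polar, polar, ← Complex.exp_add]
  push_cast
  ring_nf

lemma norm_polar (X Y : ℝ) : ‖polar X Y‖ = Real.exp (-X) := by simp [polar, Complex.norm_exp]

lemma polar_ne_zero (X Y : ℝ) : polar X Y ≠ 0 := Complex.exp_ne_zero _

lemma polar_zero : polar 0 0 = 1 := by simp [polar]

lemma continuous_polar : Continuous fun p : ℝ × ℝ => polar p.1 p.2 := by
  unfold polar
  fun_prop

lemma exists_polar {z : ℂ} (hz : z ≠ 0) : ∃ X Y, z = polar X Y := by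
  refine ⟨-(Complex.log z).re, -(Complex.log z).im, ?_⟩
  rw [polar]
  push_cast
  rw [show -(-((Complex.log z).re : ℂ) + -((Complex.log z).im : ℂ) * Complex.I)
    = (Complex.log z).re + (Complex.log z).im * Complex.I by ring, Complex.re_add_im,
    Complex.exp_log hz]

lemma polar_eq_iff {X Y X' Y' : ℝ} :
    polar X Y = polar X' Y' ↔ X = X' ∧ ∃ n : ℤ, Y = Y' + n * (2 * Real.pi) := by
  constructor
  · intro h
    obtain ⟨n, hn⟩ := Complex.exp_eq_exp_iff_exists_int.1 h
    have h1 := congrArg Complex.re hn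
    have h2 := congrArg Complex.im hn
    simp at h1 h2
    exact ⟨h1, -n, by push_cast; linarith⟩
  · rintro ⟨rfl, n, rfl⟩
    refine Complex.exp_eq_exp_iff_exists_int.2 ⟨-n, ?_⟩
    push_cast
    ring

/-- The parameter of the circle that belongs to the radius `exp (-X)`. -/
def circleTime (lam : ℂ) (X : ℝ) : ℝ := Real.exp X * Real.sin (lower lam X) / lam.im

/-- Law of sines in the triangle 0, 1, 1 + λt. If θ is the angle at 0 and exp X = |1 + λt|, the
angle at 1 + λt is arg λ - θ, so sin(arg λ - θ) = exp(-X) · sin(arg λ). This is the origin of the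
formula for `lower`; the imaginary part then determines t. -/
lemma one_add_circleTime (hre : 0 < lam.re) (him : 0 < lam.im) {X : ℝ} (hX : 0 ≤ X) :
    1 + lam * circleTime lam X = Complex.exp (X + lower lam X * Complex.I) := by
  have hn := norm_pos_of_re hre
  have hs := sine_pos hre him
  have h1 := sine_mul_exp_lt_one hre him hX
  have h0 : 0 < sine lam * Real.exp (-X) := by positivity
  have hsl := sine_lt_one hre
  have hsin : Real.sin (lower lam X) =
      sine lam * √(1 - (sine lam * Real.exp (-X)) ^ 2)
        - lam.re / ‖lam‖ * (sine lam * Real.exp (-X)) := by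
    rw [lower, Real.sin_sub, Real.sin_arcsin (by linarith) hsl.le, Real.cos_arcsin,
      Real.sin_arcsin (by linarith) h1.le, Real.cos_arcsin, sqrt_one_sub_sine_sq hre]
  have hcos : Real.cos (lower lam X) =
      lam.re / ‖lam‖ * √(1 - (sine lam * Real.exp (-X)) ^ 2)
        + sine lam * (sine lam * Real.exp (-X)) := by
    rw [lower, Real.cos_sub, Real.sin_arcsin (by linarith) hsl.le, Real.cos_arcsin,
      Real.sin_arcsin (by linarith) h1.le, Real.cos_arcsin, sqrt_one_sub_sine_sq hre]
  have hsq := sq_norm_eq lam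
  apply Complex.ext
  · rw [Complex.exp_re]
    simp only [Complex.add_re, Complex.one_re, Complex.mul_re, Complex.ofReal_re,
      Complex.ofReal_im, Complex.I_re, Complex.I_im, Complex.add_im, Complex.mul_im]
    simp only [mul_zero, mul_one, sub_zero, add_zero, zero_add]
    unfold circleTime
    rw [hsin, hcos]
    generalize √(1 - (sine lam * Real.exp (-X)) ^ 2) = c at *
    rw [Real.exp_neg] at *
    unfold sine at *
    have := (Real.exp_pos X).ne'
    field_simp
    linear_combination hsq
  · rw [Complex.exp_im]
    simp only [Complex.add_im, Complex.one_im, Complex.mul_im, Complex.ofReal_re,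
      Complex.ofReal_im, Complex.I_re, Complex.I_im, Complex.add_re, Complex.mul_re]
    simp only [mul_zero, mul_one, sub_zero, add_zero, zero_add]
    unfold circleTime
    field_simp

lemma circleTime_nonneg (hre : 0 < lam.re) (him : 0 < lam.im) {X : ℝ} (hX : 0 ≤ X) :
    0 ≤ circleTime lam X := by
  have hs := sine_pos hre him
  have h : sine lam * Real.exp (-X) ≤ sine lam := by
    have : Real.exp (-X) ≤ 1 := Real.exp_le_one_iff.2 (by linarith)
    nlinarith
  have hl : 0 ≤ lower lam X := sub_nonneg.2 (Real.monotone_arcsin h)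
  have h0 : 0 ≤ Real.arcsin (sine lam * Real.exp (-X)) := Real.arcsin_nonneg.2 (by positivity)
  have h1 := Real.arcsin_le_pi_div_two (sine lam)
  have hu : lower lam X ≤ Real.pi := by unfold lower; linarith [Real.pi_pos]
  have := Real.sin_nonneg_of_nonneg_of_le_pi hl hu
  unfold circleTime
  positivity

/-- This allows the circle to be parametrized by X = log |1 + λt| instead of t. -/
lemma strictMonoOn_norm_one_add (hre : 0 < lam.re) :
    StrictMonoOn (fun t : ℝ => ‖1 + lam * t‖) (Ici 0) := by
  intro a ha b hb hab
  have ha : 0 ≤ a := ha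
  refine lt_of_pow_lt_pow_left₀ 2 (norm_nonneg _) ?_
  rw [sq_norm_eq, sq_norm_eq]
  simp
  have h1 : 1 + lam.re * a < 1 + lam.re * b := by nlinarith
  have h2 : 0 ≤ lam.re * a := by positivity
  have h3 : (lam.im * a) ^ 2 ≤ (lam.im * b) ^ 2 := by
    rw [mul_pow, mul_pow]
    gcongr
  have h4 : (1 + lam.re * a) ^ 2 < (1 + lam.re * b) ^ 2 := by gcongr
  linarith

lemma norm_one_add_circleTime (hre : 0 < lam.re) (him : 0 < lam.im) {X : ℝ} (hX : 0 ≤ X) :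
    ‖1 + lam * circleTime lam X‖ = Real.exp X := by
  rw [one_add_circleTime hre him hX]
  simp [Complex.norm_exp]

lemma strictMonoOn_circleTime (hre : 0 < lam.re) (him : 0 < lam.im) :
    StrictMonoOn (circleTime lam) (Ici 0) := by
  intro a ha b hb hab
  rw [← (strictMonoOn_norm_one_add hre).lt_iff_lt (circleTime_nonneg hre him ha)
    (circleTime_nonneg hre him hb)]
  simp only [norm_one_add_circleTime hre him ha, norm_one_add_circleTime hre him hb]
  exact Real.exp_lt_exp.2 hab

lemma circleTime_zero : circleTime lam 0 = 0 := by simp [circleTime, lower_zero]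

lemma exists_circleTime (hre : 0 < lam.re) (him : 0 < lam.im) {t : ℝ} (ht : 0 ≤ t) :
    ∃ X, 0 ≤ X ∧ circleTime lam X = t := by
  have h1 : 1 ≤ ‖1 + lam * t‖ := by
    simpa using (strictMonoOn_norm_one_add hre).monotoneOn self_mem_Ici ht ht
  have hX := Real.log_nonneg h1
  refine ⟨_, hX, (strictMonoOn_norm_one_add hre).injOn (circleTime_nonneg hre him hX) ht ?_⟩
  simp only [norm_one_add_circleTime hre him hX]
  exact Real.exp_log (by linarith)

lemma circle_eq_polar (hre : 0 < lam.re) (him : 0 < lam.im) {X : ℝ} (hX : 0 ≤ X) :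
    1 / (1 + lam * circleTime lam X) = polar X (lower lam X) := by
  rw [one_add_circleTime hre him hX, polar, Complex.exp_neg, one_div]

lemma spiral_eq_polar (hre : 0 < lam.re) (s : ℝ) :
    Complex.exp (-lam * s) = polar (lam.re * s) (slope lam * (lam.re * s)) := by
  rw [polar]
  congr 1
  unfold slope
  have : lam.im / lam.re * (lam.re * s) = lam.im * s := by field_simp
  rw [this]
  push_cast
  conv_lhs => rw [← Complex.re_add_im lam]
  ring

/-! ### Invariance as a multiplicative semigroup condition -/

lemma deriv_powBranch {u : ℂ} {U : Set ℂ} {L : ℂ → ℂ} (h : IsLogBranch u U L) (t : ℝ) {z : ℂ}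
    (hz : z ∈ U) : z - u ≠ 0 ∧ deriv (powBranch t L) z = powBranch t L z * (t / (z - u)) := by
  obtain ⟨hU, hL, he⟩ := h
  have hzu : z - u ≠ 0 := by rw [← he z hz]; exact Complex.exp_ne_zero _
  have hd : HasDerivAt L (deriv L z) z := (hL.differentiableAt (hU.mem_nhds hz)).hasDerivAt
  have h1 : HasDerivAt (fun w => w - u) (Complex.exp (L z) * deriv L z) z :=
    hd.cexp.congr_of_eventuallyEq
      (Filter.eventuallyEq_of_mem (hU.mem_nhds hz) fun w hw => (he w hw).symm)
  have h2 := h1.unique ((hasDerivAt_id z).sub_const u)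
  rw [he z hz] at h2
  have h3 : deriv L z = 1 / (z - u) := by field_simp; linear_combination h2
  refine ⟨hzu, ?_⟩
  have h4 : HasDerivAt (powBranch t L) (Complex.exp (t * L z) * (t * deriv L z)) z :=
    (hd.const_mul (t : ℂ)).cexp
  rw [h4.deriv, h3, powBranch]
  ring

lemma exists_isLogBranch {u z : ℂ} (h : z ≠ u) : ∃ U L, IsLogBranch u U L ∧ z ∈ U := by
  have hz : z - u ≠ 0 := sub_ne_zero.2 h
  refine ⟨(fun w => (w - u) / (z - u)) ⁻¹' Complex.slitPlane,
    fun w => Complex.log ((w - u) / (z - u)) + Complex.log (z - u), ⟨?_, ?_, ?_⟩, ?_⟩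
  · exact Complex.isOpen_slitPlane.preimage (by fun_prop)
  · intro w hw
    exact (((differentiableAt_id.sub_const u).div_const (z - u)).clog hw
      |>.add_const _).differentiableWithinAt
  · intro w hw
    rw [Complex.exp_add, Complex.exp_log (Complex.slitPlane_ne_zero hw), Complex.exp_log hz]
    field_simp
  · simp [div_self hz]

/-- T((z - u)^t) = (z - 1)^k (z - u)^(t-1) (z(1 + λt) - u), and the power of z - u has no zero on
the domain of a branch. -/
lemma diffOp_powBranch {k : ℕ} (hk : 1 ≤ k) {u : ℂ} {U : Set ℂ} {L : ℂ → ℂ}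
    (h : IsLogBranch u U L) (t : ℝ) {z : ℂ} (hz : z ∈ U) :
    diffOp (C lam * (X - 1) ^ k * X) ((X - 1) ^ k) (powBranch t L) z = 0 ↔
      z = 1 ∨ z * (1 + lam * t) = u := by
  obtain ⟨hzu, hd⟩ := deriv_powBranch h t hz
  have hne : powBranch t L z ≠ 0 := Complex.exp_ne_zero _
  rw [diffOp, hd]
  have : eval z (C lam * (X - 1) ^ k * X) * (powBranch t L z * (t / (z - u)))
      + eval z ((X - 1) ^ k) * powBranch t L z
      = (z - 1) ^ k * (powBranch t L z / (z - u)) * (z * (1 + lam * t) - u) := by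
    simp
    field_simp
    ring
  rw [this, mul_eq_zero, mul_eq_zero, sub_eq_zero (a := z * _), pow_eq_zero_iff (by omega),
    sub_eq_zero]
  simp [hne, hzu]

lemma isRootOfImage_iff {k : ℕ} (hk : 1 ≤ k) {u : ℂ} {t : ℝ} {z : ℂ} :
    IsRootOfImage (C lam * (X - 1) ^ k * X) ((X - 1) ^ k) u t z ↔
      z ≠ u ∧ (z = 1 ∨ z * (1 + lam * t) = u) := by
  constructor
  · rintro ⟨U, L, h, hz, h0⟩
    exact ⟨sub_ne_zero.1 (deriv_powBranch h t hz).1, (diffOp_powBranch hk h t hz).1 h0⟩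
  · rintro ⟨hzu, h0⟩
    obtain ⟨U, L, h, hz⟩ := exists_isLogBranch hzu
    exact ⟨U, L, h, hz, (diffOp_powBranch hk h t hz).2 h0⟩

lemma one_add_mul_ne_zero (hre : 0 < lam.re) {t : ℝ} (ht : 0 ≤ t) : 1 + lam * t ≠ 0 := by
  intro h
  have := congrArg Complex.re h
  simp at this
  nlinarith [mul_nonneg hre.le ht]

lemma not_imageVanishes (hre : 0 < lam.re) {k : ℕ} (hk : 1 ≤ k) {u : ℂ} {t : ℝ} (ht : 0 ≤ t) :
    ¬ ImageVanishes (C lam * (X - 1) ^ k * X) ((X - 1) ^ k) u t := by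
  intro hv
  obtain ⟨z, hz⟩ := Infinite.exists_notMem_finset ({u, 1, u / (1 + lam * t)} : Finset ℂ)
  simp only [Finset.mem_insert, Finset.mem_singleton, not_or] at hz
  obtain ⟨U, L, h, hzU⟩ := exists_isLogBranch hz.1
  rcases (diffOp_powBranch hk h t hzU).1 (hv U L h z hzU) with h1 | h1
  · exact hz.2.1 h1
  · exact hz.2.2 (by rw [← h1, mul_div_cancel_right₀ _ (one_add_mul_ne_zero hre ht)])

/-- The definition of a root excludes z = u, but u lies in S anyway. The factor (z - 1)^k puts 1
into every invariant set. -/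
theorem isTCHInvariant_iff (hre : 0 < lam.re) {k : ℕ} (hk : 1 ≤ k) {S : Set ℂ} :
    IsTCHInvariant (C lam * (X - 1) ^ k * X) ((X - 1) ^ k) S ↔
      IsClosed S ∧ 1 ∈ S ∧ ∀ u ∈ S, ∀ t : ℝ, 0 ≤ t → u * (1 / (1 + lam * t)) ∈ S := by
  constructor
  · rintro ⟨⟨u, hu⟩, hc, hr⟩
    have key : ∀ u ∈ S, ∀ t : ℝ, 0 ≤ t → ∀ z, z ≠ u → (z = 1 ∨ z * (1 + lam * t) = u) → z ∈ S :=
      fun u hu t ht z h1 h2 => ((hr u hu t ht).resolve_left (not_imageVanishes hre hk ht)) z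
        ((isRootOfImage_iff hk).2 ⟨h1, h2⟩)
    refine ⟨hc, ?_, fun u hu t ht => ?_⟩
    · rcases eq_or_ne 1 u with rfl | h
      · exact hu
      · exact key u hu 0 le_rfl 1 h (Or.inl rfl)
    · by_cases h : u * (1 / (1 + lam * t)) = u
      · rwa [h]
      · have := one_add_mul_ne_zero hre ht
        exact key u hu t ht _ h (Or.inr (by field_simp))
  · rintro ⟨hc, h1, hm⟩
    refine ⟨⟨1, h1⟩, hc, fun u hu t ht => Or.inr fun z hz => ?_⟩
    rcases ((isRootOfImage_iff hk).1 hz).2 with rfl | h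
    · exact h1
    · convert hm u hu t ht using 1
      have := one_add_mul_ne_zero hre ht
      rw [← h]
      field_simp

theorem isLeast_minimalSet (hre : 0 < lam.re) {k : ℕ} (hk : 1 ≤ k) :
    IsLeast {S | IsTCHInvariant (C lam * (X - 1) ^ k * X) ((X - 1) ^ k) S}
      (minimalSet (C lam * (X - 1) ^ k * X) ((X - 1) ^ k)) := by
  refine ⟨(isTCHInvariant_iff hre hk).2 ⟨isClosed_sInter fun S hS => hS.isClosed, ?_, ?_⟩,
    fun S hS => sInter_subset_of_mem hS⟩
  · exact fun S hS => ((isTCHInvariant_iff hre hk).1 hS).2.1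
  · exact fun u hu t ht S hS => ((isTCHInvariant_iff hre hk).1 hS).2.2 u (hu S hS) t ht

lemma tendsto_circle_zero (hre : 0 < lam.re) :
    Filter.Tendsto (fun n : ℕ => 1 / (1 + lam * (n : ℝ))) Filter.atTop (nhds 0) := by
  have hl : lam ≠ 0 := fun h => by simp [h] at hre
  simp only [one_div]
  refine Filter.tendsto_inv₀_cobounded.comp ?_
  rw [← tendsto_norm_atTop_iff_cobounded]
  have h1 : Filter.Tendsto (fun n : ℕ => ‖lam‖ * n - 1) Filter.atTop Filter.atTop :=
    Filter.tendsto_atTop_add_const_right _ _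
      (tendsto_natCast_atTop_atTop.const_mul_atTop (norm_pos_iff.2 hl))
  refine Filter.tendsto_atTop_mono (fun n => ?_) h1
  have := norm_sub_le (1 + lam * (n : ℝ)) 1
  simp at this ⊢
  linarith

lemma zero_mem_of_invariant (hre : 0 < lam.re) {S : Set ℂ} (hc : IsClosed S) (h1 : 1 ∈ S)
    (hm : ∀ u ∈ S, ∀ t : ℝ, 0 ≤ t → u * (1 / (1 + lam * t)) ∈ S) : 0 ∈ S :=
  hc.mem_of_tendsto (tendsto_circle_zero hre)
    (.of_forall fun n => by simpa using hm 1 h1 n n.cast_nonneg)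

/-- Euler's limit: (1 + λs/n)^(-n) tends to exp(-λs), and S is closed. -/
lemma mul_spiral_mem_of_invariant {S : Set ℂ} (hc : IsClosed S)
    (hm : ∀ u ∈ S, ∀ t : ℝ, 0 ≤ t → u * (1 / (1 + lam * t)) ∈ S) {u : ℂ} (hu : u ∈ S) {s : ℝ}
    (hs : 0 ≤ s) : u * Complex.exp (-lam * s) ∈ S := by
  have hpow : ∀ t : ℝ, 0 ≤ t → ∀ n : ℕ, u * (1 / (1 + lam * t)) ^ n ∈ S := by
    intro t ht n
    induction n with
    | zero => simpa using hu
    | succ n ih => rw [pow_succ, ← mul_assoc]; exact hm _ ih t ht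
  have hlim := ((Complex.tendsto_one_add_div_pow_exp (lam * s)).inv₀
    (Complex.exp_ne_zero _)).const_mul u
  rw [neg_mul, Complex.exp_neg]
  refine hc.mem_of_tendsto hlim (.of_forall fun n => ?_)
  have := hpow (s / n) (by positivity) n
  rw [one_div, inv_pow] at this
  have h : 1 + lam * s / n = 1 + lam * ((s / n : ℝ) : ℂ) := by push_cast; ring
  rwa [h]

/-! ### The linear field λz: poles, inflections, rays and trajectories -/

lemma ratio_eq {k : ℕ} : ratio (C lam * (X - 1) ^ k * X) ((X - 1) ^ k)
    = algebraMap ℂ[X] (RatFunc ℂ) (C lam * X) := by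
  have h : algebraMap ℂ[X] (RatFunc ℂ) ((X - 1) ^ k) ≠ 0 :=
    RatFunc.algebraMap_ne_zero (pow_ne_zero _ (by simpa using X_sub_C_ne_zero (1 : ℂ)))
  rw [ratio, div_eq_iff h, ← map_mul, mul_right_comm]

lemma field_eq {k : ℕ} : field (C lam * (X - 1) ^ k * X) ((X - 1) ^ k) = fun z => lam * z := by
  funext z
  rw [field, ratio_eq, RatFunc.eval_algebraMap]
  simp

lemma poles_eq {k : ℕ} : poles (C lam * (X - 1) ^ k * X) ((X - 1) ^ k) = ∅ := by
  ext z
  simp only [poles, ratio_eq, RatFunc.denom_algebraMap]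
  simp

lemma inflectionCurve_eq (him : 0 < lam.im) {k : ℕ} :
    inflectionCurve (C lam * (X - 1) ^ k * X) ((X - 1) ^ k) = ∅ := by
  have hd (z : ℂ) : deriv (fun z => lam * z) z = lam := by
    simp
  rw [inflectionCurve, field_eq]
  simp [hd, him.ne']

lemma zeroSet_eq (hre : 0 < lam.re) {k : ℕ} (hk : 1 ≤ k) :
    zeroSet (C lam * (X - 1) ^ k * X) ((X - 1) ^ k) = {0, 1} := by
  have hl : lam ≠ 0 := fun h => by simp [h] at hre
  have hk : k ≠ 0 := by omega
  ext z
  simp only [zeroSet, mem_ofPred_eq, eval_mul, eval_pow, eval_sub, eval_X, eval_one, eval_C,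
    mul_eq_zero, hl, false_or, pow_eq_zero_iff hk, sub_eq_zero, mem_insert_iff, mem_singleton_iff]
  tauto

lemma ray_eq {k : ℕ} {x : ℂ} (hx : x ≠ 1) :
    ray (C lam * (X - 1) ^ k * X) ((X - 1) ^ k) x =
      {y | ∃ t : ℝ, 0 ≤ t ∧ y = x * (1 + lam * t)} := by
  have hx := pow_ne_zero k (sub_ne_zero.2 hx)
  have : eval x (C lam * (X - 1) ^ k * X) / eval x ((X - 1) ^ k) = lam * x := by
    simp
    field_simp
  simp only [ray, this]
  ext y
  refine exists_congr fun t => and_congr_right fun _ => ?_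
  rw [show x * (1 + lam * t) = x + t * (lam * x) by ring]

lemma positiveTrajectory_eq {k : ℕ} {x : ℂ} :
    positiveTrajectory (C lam * (X - 1) ^ k * X) ((X - 1) ^ k) x =
      {y | ∃ s : ℝ, 0 ≤ s ∧ y = x * Complex.exp (lam * s)} := by
  have hder : ∀ s : ℝ, HasDerivAt (fun s : ℝ => Complex.exp (lam * s))
      (Complex.exp (lam * s) * lam) s := by
    intro s
    have h := ((Complex.ofRealCLM.hasDerivAt (x := s)).const_mul lam).cexp
    simpa using h
  ext y
  constructor
  · rintro ⟨τ, c, hτ, ⟨-, hc⟩, h0, hy⟩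
    refine ⟨τ, hτ, ?_⟩
    -- Integrating factor: c' = λc makes c(s) exp(-λs) constant.
    have hconst : ∀ s ∈ Icc 0 τ,
        c s * Complex.exp (-lam * s) = c 0 * Complex.exp (-lam * (0 : ℝ)) := by
      have hd : ∀ s ∈ Icc 0 τ, HasDerivWithinAt (fun s : ℝ => c s * Complex.exp (-lam * s)) 0
          (Icc 0 τ) s := by
        intro s hs
        have h1 := hc s hs
        simp only [field_eq] at h1
        have h2 := ((Complex.ofRealCLM.hasDerivAt (x := s)).const_mul (-lam)).cexp
        have h3 := h1.mul h2.hasDerivWithinAt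
        refine h3.congr_deriv ?_
        simp
        ring
      refine constant_of_derivWithin_zero (fun s hs => (hd s hs).differentiableWithinAt)
        fun s hs => (hd s (Ico_subset_Icc_self hs)).derivWithin ?_
      exact uniqueDiffOn_Icc (hs.1.trans_lt hs.2) s (Ico_subset_Icc_self hs)
    have h := hconst τ ⟨hτ, le_rfl⟩
    rw [hy, h0] at h
    simp only [Complex.ofReal_zero, mul_zero, Complex.exp_zero, mul_one] at h
    rw [← h, mul_assoc, ← Complex.exp_add]
    simp
  · rintro ⟨s, hs, rfl⟩
    refine ⟨s, fun r => x * Complex.exp (lam * r), hs, ⟨by simp [poles_eq], ?_⟩, by simp, rfl⟩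
    intro r _
    simp only [field_eq]
    exact (((hder r).const_mul x).congr_deriv (by ring)).hasDerivWithinAt

lemma isIntegralArc_spiral {k : ℕ} {t₀ : ℝ} (ht : 0 < t₀) :
    IsIntegralArc (C lam * (X - 1) ^ k * X) ((X - 1) ^ k)
      ((fun t : ℝ => Complex.exp (-lam * t)) '' Ioo 0 t₀) := by
  -- γ runs against the field, so time is reversed.
  refine ⟨Ioo (-t₀) 0, fun t => Complex.exp (lam * t), isOpen_Ioo, ordConnected_Ioo,
    nonempty_Ioo.2 (by linarith), ⟨by simp [poles_eq], ?_⟩, ?_⟩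
  · intro r _
    simp only [field_eq]
    have h := ((Complex.ofRealCLM.hasDerivAt (x := r)).const_mul lam).cexp
    refine (h.congr_deriv ?_).hasDerivWithinAt
    simp
    ring
  · ext z
    constructor
    · rintro ⟨t, ht, rfl⟩
      exact ⟨-t, ⟨by linarith [ht.2], by linarith [ht.1]⟩, by simp⟩
    · rintro ⟨t, ht, rfl⟩
      exact ⟨-t, ⟨by linarith [ht.2], by linarith [ht.1]⟩, by simp⟩

/-! ### Compact sets in the extended plane -/

open ExtendedPlane

lemma isOpen_point_image {U : Set ℂ} (hU : IsOpen U) : IsOpen (point '' U) :=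
  TopologicalSpace.isOpen_generateFrom_of_mem (Or.inl ⟨U, hU, rfl⟩)

/-- Compact sets of the plane stay closed in the extended plane. -/
theorem extClosure_eq_of_isCompact {M : Set ℂ} (hM : IsCompact M) :
    extClosure M = point '' M := by
  refine IsClosed.closure_eq ?_
  rw [← isOpen_compl_iff, isOpen_iff_forall_mem_open]
  rintro (z | θ) hx
  · refine ⟨point '' Mᶜ, ?_, isOpen_point_image hM.isClosed.isOpen_compl, z, ?_, rfl⟩
    · rintro _ ⟨w, hw, rfl⟩ ⟨v, hv, h⟩
      exact hw (by cases h; exact hv)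
    · exact fun h => hx ⟨z, h, rfl⟩
  · obtain ⟨B, hB⟩ := hM.isBounded.exists_norm_le
    -- I is the open half circle around θ. Every point of the cone with apex (B + 1)θ over I has
    -- component greater than B + 1 along θ, so the cone misses M.
    set I : Set Circle := {φ | 0 < ((φ : ℂ) * (starRingEnd ℂ) (θ : ℂ)).re}
    have hI : IsOpen I := isOpen_lt continuous_const (by fun_prop)
    refine ⟨direction '' I ∪ point '' cone ((B + 1 : ℝ) * (θ : ℂ)) I, ?_,
      TopologicalSpace.isOpen_generateFrom_of_mem (Or.inr ⟨_, I, hI, rfl⟩),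
      Or.inl ⟨θ, ?_, rfl⟩⟩
    · rintro _ (⟨φ, hφ, rfl⟩ | ⟨w, ⟨r, hr, φ, hφ, rfl⟩, rfl⟩) ⟨v, hv, h⟩
      · cases h
      · cases h
        have h1 := hB _ hv
        have hθ : (θ : ℂ) * (starRingEnd ℂ) (θ : ℂ) = 1 := by
          rw [Complex.mul_conj, Complex.normSq_eq_norm_sq, Circle.norm_coe]; simp
        have h2 := Complex.re_le_norm
          (((B + 1 : ℝ) * (θ : ℂ) + r * (φ : ℂ)) * (starRingEnd ℂ) (θ : ℂ))
        rw [norm_mul, RCLike.norm_conj, Circle.norm_coe, mul_one, add_mul, mul_assoc, hθ,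
          mul_assoc, Complex.add_re, Complex.re_ofReal_mul, Complex.re_ofReal_mul,
          Complex.one_re] at h2
        have h3 : 0 < r * ((φ : ℂ) * (starRingEnd ℂ) (θ : ℂ)).re := mul_pos hr hφ
        linarith
    · change 0 < ((θ : ℂ) * (starRingEnd ℂ) (θ : ℂ)).re
      rw [Complex.mul_conj, Complex.normSq_eq_norm_sq, Circle.norm_coe]; simp

lemma mem_extClosure_of_point {S : Set ℂ} {z : ℂ} (h : point z ∈ extClosure S) :
    z ∈ closure S := by
  rw [extClosure, mem_closure_iff] at h
  rw [mem_closure_iff]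
  intro U hU hz
  obtain ⟨_, ⟨w, hw, rfl⟩, v, hv, h⟩ := h _ (isOpen_point_image hU) ⟨z, hz, rfl⟩
  cases h
  exact ⟨_, hw, hv⟩

/-! ### Identification of the minimal set -/

variable {X₀ : ℝ}

/-- The closed region between the circle and the spiral in logarithmic coordinates. -/
def strip (lam : ℂ) (X₀ : ℝ) : Set (ℝ × ℝ) :=
  {p | 0 ≤ p.1 ∧ p.1 ≤ X₀ ∧ lower lam p.1 ≤ p.2 ∧ p.2 ≤ slope lam * p.1}

/-- The region enclosed by the arcs of the circle and of the spiral up to the radius `exp (-X₀)`. -/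
def spiralSet (lam : ℂ) (X₀ : ℝ) : Set ℂ :=
  Metric.closedBall 0 (Real.exp (-X₀)) ∪ (fun p : ℝ × ℝ => polar p.1 p.2) '' strip lam X₀

lemma slope_mul_eq (X : ℝ) : slope lam * X = lower lam X + gap lam X := by
  unfold gap; ring

/-- For X ≥ X₀ the band has angular width at least 2π, so it covers the whole circle of radius
exp(-X). Thus the disc, apart from 0, is just the continuation of the strip, and the upper bound on
X can be dropped. -/
lemma polar_mem_spiralSet (hre : 0 < lam.re) (him : 0 < lam.im) (h0 : 0 < X₀)
    (hg : gap lam X₀ = 2 * Real.pi) {X Y : ℝ} :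
    polar X Y ∈ spiralSet lam X₀ ↔
      0 ≤ X ∧ ∃ n : ℤ, lower lam X ≤ Y + n * (2 * Real.pi) ∧
        Y + n * (2 * Real.pi) ≤ slope lam * X := by
  constructor
  · rintro (h | ⟨⟨X', Y'⟩, ⟨h1, -, h3, h4⟩, h⟩)
    · rw [mem_closedBall_zero_iff, norm_polar, Real.exp_le_exp, neg_le_neg_iff] at h
      have hX : 0 ≤ X := h0.le.trans h
      have h2 : 2 * Real.pi ≤ gap lam X := by
        rw [← hg]; exact (strictMonoOn_gap hre him).monotoneOn h0.le hX h
      obtain ⟨n, hn, -⟩ := existsUnique_add_zsmul_mem_Ico Real.two_pi_pos Y (lower lam X)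
      rw [zsmul_eq_mul] at hn
      refine ⟨hX, n, hn.1, ?_⟩
      rw [slope_mul_eq]
      linarith [hn.2]
    · obtain ⟨rfl, n, rfl⟩ := polar_eq_iff.1 h
      exact ⟨h1, n, h3, h4⟩
  · rintro ⟨hX, n, h1, h2⟩
    rcases le_total X X₀ with h | h
    · exact Or.inr ⟨(X, Y + n * (2 * Real.pi)), ⟨hX, h, h1, h2⟩, polar_eq_iff.2 ⟨rfl, n, rfl⟩⟩
    · refine Or.inl ?_
      rw [mem_closedBall_zero_iff, norm_polar]
      exact Real.exp_le_exp.2 (by linarith)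

lemma isCompact_strip : IsCompact (strip lam X₀) := by
  have hl := continuous_lower (lam := lam)
  obtain ⟨a, ha⟩ := (isCompact_Icc (a := (0 : ℝ)) (b := X₀)).bddBelow_image hl.continuousOn
  obtain ⟨b, hb⟩ := (isCompact_Icc (a := (0 : ℝ)) (b := X₀)).bddAbove_image
    (f := fun X => slope lam * X) (by fun_prop)
  refine (isCompact_Icc (a := ((0 : ℝ), a)) (b := (X₀, b))).of_isClosed_subset ?_ ?_
  · refine (isClosed_le continuous_const continuous_fst).inter
      ((isClosed_le continuous_fst continuous_const).inter
        ((isClosed_le (hl.comp continuous_fst) continuous_snd).inter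
          (isClosed_le continuous_snd (by fun_prop))))
  · rintro ⟨X, Y⟩ ⟨h1, h2, h3, h4⟩
    exact ⟨⟨h1, (ha ⟨X, ⟨h1, h2⟩, rfl⟩).trans h3⟩, ⟨h2, h4.trans (hb ⟨X, ⟨h1, h2⟩, rfl⟩)⟩⟩

lemma isCompact_spiralSet : IsCompact (spiralSet lam X₀) :=
  (isCompact_closedBall _ _).union (isCompact_strip.image continuous_polar)

theorem minimalSet_eq (hre : 0 < lam.re) (him : 0 < lam.im) (h0 : 0 < X₀)
    (hg : gap lam X₀ = 2 * Real.pi) {k : ℕ} (hk : 1 ≤ k) :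
    minimalSet (C lam * (X - 1) ^ k * X) ((X - 1) ^ k) = spiralSet lam X₀ := by
  apply subset_antisymm
  · refine (isLeast_minimalSet hre hk).2 ((isTCHInvariant_iff hre hk).2
      ⟨isCompact_spiralSet.isClosed, ?_, fun u hu t ht => ?_⟩)
    · rw [← polar_zero, polar_mem_spiralSet hre him h0 hg]
      exact ⟨le_rfl, 0, by simp [lower_zero]⟩
    · obtain ⟨A, hA, rfl⟩ := exists_circleTime hre him ht
      rw [circle_eq_polar hre him hA]
      rcases eq_or_ne u 0 with rfl | hu0
      · simpa using hu
      obtain ⟨A', B', rfl⟩ := exists_polar hu0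
      obtain ⟨hA', n, h1, h2⟩ := (polar_mem_spiralSet hre him h0 hg).1 hu
      rw [polar_mul, polar_mem_spiralSet hre him h0 hg]
      refine ⟨add_nonneg hA' hA, n, ?_, ?_⟩
      -- Superadditivity of `gap` is subadditivity of `lower`, which preserves the lower edge; the
      -- upper edge is preserved because the circle lies below the line.
      · have := gap_add_le hre him hA' hA
        unfold gap at this
        linarith
      · have := gap_nonneg hre him hA
        unfold gap at this
        linarith
  · obtain ⟨hc, h1, hm⟩ := (isTCHInvariant_iff hre hk).1 (isLeast_minimalSet hre hk).1
    intro z hz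
    rcases eq_or_ne z 0 with rfl | hz0
    · exact zero_mem_of_invariant hre hc h1 hm
    obtain ⟨A, B, rfl⟩ := exists_polar hz0
    obtain ⟨hA, n, h2, h3⟩ := (polar_mem_spiralSet hre him h0 hg).1 hz
    set B' := B + n * (2 * Real.pi) with hB'
    have hz' : polar A B = polar A B' := (polar_eq_iff.2 ⟨rfl, n, hB'⟩).symm
    -- The spiral flow preserves slope · X - Y, so the target is reached from the circle point at A₁
    -- with gap A₁ = slope · A - B'.
    have hin : slope lam * A - B' ∈ Icc (gap lam 0) (gap lam A) := by
      rw [gap_zero]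
      exact ⟨by linarith, by unfold gap; linarith⟩
    obtain ⟨A₁, hA₁, he⟩ := intermediate_value_Icc hA
      (continuous_gap (lam := lam)).continuousOn hin
    have hsp := mul_spiral_mem_of_invariant hc hm (hm 1 h1 _ (circleTime_nonneg hre him hA₁.1))
      (s := (A - A₁) / lam.re) (div_nonneg (sub_nonneg.2 hA₁.2) hre.le)
    rw [one_mul, circle_eq_polar hre him hA₁.1, spiral_eq_polar hre, polar_mul,
      mul_div_cancel₀ _ hre.ne'] at hsp
    rw [hz']
    convert hsp using 2
    · ring
    · unfold gap at he
      linarith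

/-! ### The boundary of the minimal set -/

lemma isOpenMap_polar : IsOpenMap fun p : ℝ × ℝ => polar p.1 p.2 := by
  have : (fun p : ℝ × ℝ => polar p.1 p.2) =
      Complex.exp ∘ (Homeomorph.neg ℂ) ∘ Complex.equivRealProdCLM.symm := by
    funext p
    simp [polar, Complex.equivRealProdCLM_symm_apply, add_comm]
  rw [this]
  exact Complex.isOpenMap_exp.comp
    ((Homeomorph.isOpenMap _).comp Complex.equivRealProdCLM.symm.toHomeomorph.isOpenMap)

/-- Before X₀ a free sector of angle 2π - gap X > 0 remains at radius exp(-X), adjacent to both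
edges; its points approach each edge from outside. -/
lemma spiral_point_mem_frontier (hre : 0 < lam.re) (him : 0 < lam.im) (h0 : 0 < X₀)
    (hg : gap lam X₀ = 2 * Real.pi) {X : ℝ} (hX : X ∈ Ico 0 X₀) :
    polar X (slope lam * X) ∈ frontier (spiralSet lam X₀) ∧
      polar X (lower lam X) ∈ frontier (spiralSet lam X₀) := by
  have hgap : gap lam X < 2 * Real.pi := by
    rw [← hg]; exact strictMonoOn_gap hre him hX.1 h0.le hX.2
  have hgap0 := gap_nonneg hre him hX.1
  have hs := slope_mul_eq (lam := lam) X
  have hcont : Continuous fun e : ℝ => polar X e :=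
    continuous_polar.comp (Continuous.prodMk_right X)
  rw [frontier_eq_closure_inter_closure]
  refine ⟨⟨subset_closure ?_, ?_⟩, ⟨subset_closure ?_, ?_⟩⟩
  · rw [polar_mem_spiralSet hre him h0 hg]
    exact ⟨hX.1, 0, by simp; linarith, by simp⟩
  · have hmem : slope lam * X ∈ closure (Ioo (slope lam * X)
        (slope lam * X + (2 * Real.pi - gap lam X))) := by
      rw [closure_Ioo (by linarith)]
      exact ⟨le_rfl, by linarith⟩
    refine map_mem_closure hcont hmem fun Y hY => ?_
    rw [mem_compl_iff, polar_mem_spiralSet hre him h0 hg]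
    rintro ⟨-, n, h1, h2⟩
    have hn : n ≤ -1 := by
      have h3 : (n : ℝ) * (2 * Real.pi) < 0 := by linarith [hY.1]
      have h4 : (n : ℝ) < 0 := by
        by_contra h
        push Not at h
        nlinarith [Real.pi_pos]
      have : n < 0 := by exact_mod_cast h4
      omega
    have : (n : ℝ) ≤ -1 := by exact_mod_cast hn
    nlinarith [hY.2, Real.pi_pos]
  · rw [polar_mem_spiralSet hre him h0 hg]
    exact ⟨hX.1, 0, by simp, by simp; linarith⟩
  · have hmem : lower lam X ∈ closure (Ioo (lower lam X - (2 * Real.pi - gap lam X))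
        (lower lam X)) := by
      rw [closure_Ioo (by linarith)]
      exact ⟨by linarith, le_rfl⟩
    refine map_mem_closure hcont hmem fun Y hY => ?_
    rw [mem_compl_iff, polar_mem_spiralSet hre him h0 hg]
    rintro ⟨-, n, h1, h2⟩
    have hn : 1 ≤ n := by
      have h3 : 0 < (n : ℝ) * (2 * Real.pi) := by linarith [hY.2]
      have h4 : 0 < (n : ℝ) := by
        by_contra h
        push Not at h
        nlinarith [Real.pi_pos]
      have : 0 < n := by exact_mod_cast h4
      omega
    have : (1 : ℝ) ≤ n := by exact_mod_cast hn
    nlinarith [hY.1, Real.pi_pos]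

theorem frontier_spiralSet (hre : 0 < lam.re) (him : 0 < lam.im) (h0 : 0 < X₀)
    (hg : gap lam X₀ = 2 * Real.pi) :
    frontier (spiralSet lam X₀) = (fun X => polar X (slope lam * X)) '' Icc 0 X₀ ∪
      (fun X => polar X (lower lam X)) '' Icc 0 X₀ := by
  have hl := continuous_lower (lam := lam)
  apply subset_antisymm
  · rw [isCompact_spiralSet.isClosed.frontier_eq]
    rintro z ⟨hz, hi⟩
    have hball : z ∉ Metric.ball 0 (Real.exp (-X₀)) := fun h =>
      hi (interior_maximal (Metric.ball_subset_closedBall.trans subset_union_left)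
        Metric.isOpen_ball h)
    have hz0 : z ≠ 0 := by
      rintro rfl
      exact hball (Metric.mem_ball_self (Real.exp_pos _))
    obtain ⟨X, Y, rfl⟩ := exists_polar hz0
    rw [mem_ball_zero_iff, norm_polar, Real.exp_lt_exp, neg_lt_neg_iff, not_lt] at hball
    obtain ⟨hX, n, h1, h2⟩ := (polar_mem_spiralSet hre him h0 hg).1 hz
    have hY : polar X (Y + n * (2 * Real.pi)) = polar X Y := polar_eq_iff.2 ⟨rfl, n, rfl⟩
    rw [← hY] at hi ⊢
    generalize Y + n * (2 * Real.pi) = Y' at *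
    rcases h1.eq_or_lt with rfl | h1
    · exact Or.inr ⟨X, ⟨hX, hball⟩, rfl⟩
    rcases h2.eq_or_lt with rfl | h2
    · exact Or.inl ⟨X, ⟨hX, hball⟩, rfl⟩
    have hX : 0 < X := hX.lt_of_ne (by rintro rfl; rw [lower_zero] at h1; linarith)
    -- With both inequalities strict the band is open, and its image under the open map `polar` lies
    -- in the set, even across the radius X₀.
    have hopen : IsOpen {p : ℝ × ℝ | 0 < p.1 ∧ lower lam p.1 < p.2 ∧ p.2 < slope lam * p.1} :=
      (isOpen_lt continuous_const continuous_fst).inter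
        ((isOpen_lt (hl.comp continuous_fst) continuous_snd).inter
          (isOpen_lt continuous_snd (by fun_prop)))
    refine absurd (interior_maximal ?_ (isOpenMap_polar _ hopen) ⟨(X, Y'), ⟨hX, h1, h2⟩, rfl⟩) hi
    rintro _ ⟨⟨A, B⟩, ⟨hA, hB, hB'⟩, rfl⟩
    exact (polar_mem_spiralSet hre him h0 hg).2
      ⟨hA.le, 0, by simpa using hB.le, by simpa using hB'.le⟩
  -- At X₀ the free sector has closed up; the end point is obtained as a limit, since the frontier
  -- is closed.
  · have hsub : ∀ f : ℝ → ℂ, Continuous f → (∀ X ∈ Ico 0 X₀, f X ∈ frontier (spiralSet lam X₀)) →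
        f '' Icc 0 X₀ ⊆ frontier (spiralSet lam X₀) := by
      intro f hf h
      rw [← closure_Ico h0.ne]
      exact (image_closure_subset_closure_image hf).trans
        (isClosed_frontier.closure_subset_iff.2 (image_subset_iff.2 h))
    refine union_subset (hsub _ ?_ fun X hX => (spiral_point_mem_frontier hre him h0 hg hX).1)
      (hsub _ ?_ fun X hX => (spiral_point_mem_frontier hre him h0 hg hX).2)
    · exact continuous_polar.comp (continuous_id.prodMk (by fun_prop))
    · exact continuous_polar.comp (continuous_id.prodMk hl)

/-! ### Types of the boundary points -/

variable {k : ℕ}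

lemma extClosure_minimalSet (hre : 0 < lam.re) (him : 0 < lam.im) (h0 : 0 < X₀)
    (hg : gap lam X₀ = 2 * Real.pi) (hk : 1 ≤ k) :
    extClosure (minimalSet (C lam * (X - 1) ^ k * X) ((X - 1) ^ k)) =
      point '' spiralSet lam X₀ := by
  rw [minimalSet_eq hre him h0 hg hk, extClosure_eq_of_isCompact isCompact_spiralSet]

lemma gam_nonempty_iff (hre : 0 < lam.re) (him : 0 < lam.im) (h0 : 0 < X₀)
    (hg : gap lam X₀ = 2 * Real.pi) (hk : 1 ≤ k) {x : ℂ} :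
    (Gam (C lam * (X - 1) ^ k * X) ((X - 1) ^ k) x).Nonempty ↔
      ∃ s : ℝ, 0 ≤ s ∧ x * Complex.exp (lam * s) ≠ x ∧
        x * Complex.exp (lam * s) ∈ spiralSet lam X₀ := by
  rw [Gam, extClosure_minimalSet hre him h0 hg hk, positiveTrajectory_eq]
  constructor
  · rintro ⟨_, ⟨⟨_, ⟨s, hs, rfl⟩, rfl⟩, hne⟩, z, hz, h⟩
    cases h
    exact ⟨s, hs, fun h => hne (congrArg point h), hz⟩
  · rintro ⟨s, hs, hne, hz⟩
    exact ⟨_, ⟨⟨_, ⟨s, hs, rfl⟩, rfl⟩, fun h => hne (ExtendedPlane.point.inj h)⟩, _, hz, rfl⟩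

lemma isClosed_ray (hre : 0 < lam.re) {x : ℂ} (hx : x ≠ 0) :
    IsClosed {y | ∃ t : ℝ, 0 ≤ t ∧ y = x * (1 + lam * t)} := by
  have hl : lam ≠ 0 := fun h => by simp [h] at hre
  have : {y | ∃ t : ℝ, 0 ≤ t ∧ y = x * (1 + lam * t)} =
      {y : ℂ | 0 ≤ ((y / x - 1) / lam).re} ∩ {y | ((y / x - 1) / lam).im = 0} := by
    ext y
    constructor
    · rintro ⟨t, ht, rfl⟩
      have : (x * (1 + lam * t) / x - 1) / lam = t := by field_simp; ring
      simp only [mem_inter_iff, mem_ofPred_eq, this]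
      simpa using ht
    · rintro ⟨h1, h2⟩
      refine ⟨_, h1, ?_⟩
      have : ((((y / x - 1) / lam).re : ℝ) : ℂ) = (y / x - 1) / lam :=
        Complex.ext rfl (by simpa using h2.symm)
      rw [this]
      field_simp
      ring
  rw [this]
  exact (isClosed_le continuous_const (by fun_prop)).inter
    (isClosed_eq (by fun_prop) continuous_const)

/-- M is compact, so its extended closure contains no direction at infinity and only finite points
of the ray count. -/
lemma del_nonempty_iff (hre : 0 < lam.re) (him : 0 < lam.im) (h0 : 0 < X₀)
    (hg : gap lam X₀ = 2 * Real.pi) (hk : 1 ≤ k) {x : ℂ} (hx0 : x ≠ 0) (hx1 : x ≠ 1) :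
    (Del (C lam * (X - 1) ^ k * X) ((X - 1) ^ k) x).Nonempty ↔
      ∃ t : ℝ, 0 ≤ t ∧ x * (1 + lam * t) ≠ x ∧ x * (1 + lam * t) ∈ spiralSet lam X₀ := by
  rw [Del, extClosure_minimalSet hre him h0 hg hk, ray_eq hx1]
  constructor
  · rintro ⟨_, ⟨hr, hne⟩, z, hz, rfl⟩
    have := mem_extClosure_of_point hr
    rw [(isClosed_ray hre hx0).closure_eq] at this
    obtain ⟨t, ht, rfl⟩ := this
    exact ⟨t, ht, fun h => hne (congrArg point h), hz⟩
  · rintro ⟨t, ht, hne, hz⟩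
    exact ⟨_, ⟨subset_closure ⟨_, ⟨t, ht, rfl⟩, rfl⟩, fun h => hne (ExtendedPlane.point.inj h)⟩,
      _, hz, rfl⟩

lemma polar_ne_one {X Y : ℝ} (hX : 0 < X) : polar X Y ≠ 1 := fun h => by
  have h1 := norm_polar X Y
  rw [h, norm_one] at h1
  have := Real.exp_lt_one_iff.2 (neg_lt_zero.2 hX)
  linarith

lemma polar_mul_exp (hre : 0 < lam.re) (X Y s : ℝ) :
    polar X Y * Complex.exp (lam * s) =
      polar (X - lam.re * s) (Y - slope lam * (lam.re * s)) := by
  have h := spiral_eq_polar hre (-s)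
  rw [show -lam * ((-s : ℝ) : ℂ) = lam * s by push_cast; ring] at h
  rw [h, polar_mul]
  ring_nf

lemma polar_mul_line (hre : 0 < lam.re) (him : 0 < lam.im) {B : ℝ} (hB : 0 ≤ B) (X Y : ℝ) :
    polar X Y * (1 + lam * circleTime lam B) = polar (X - B) (Y - lower lam B) := by
  have h : polar X Y = polar (X - B) (Y - lower lam B) * polar B (lower lam B) := by
    rw [polar_mul]; ring_nf
  have := one_add_mul_ne_zero hre (circleTime_nonneg hre him hB)
  rw [h, ← circle_eq_polar hre him hB]
  field_simp

lemma one_mem_spiralSet (hre : 0 < lam.re) (him : 0 < lam.im) (h0 : 0 < X₀)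
    (hg : gap lam X₀ = 2 * Real.pi) : 1 ∈ spiralSet lam X₀ := by
  rw [← polar_zero, polar_mem_spiralSet hre him h0 hg]
  exact ⟨le_rfl, 0, by simp [lower_zero]⟩

lemma gam_spiral_nonempty (hre : 0 < lam.re) (him : 0 < lam.im) (h0 : 0 < X₀)
    (hg : gap lam X₀ = 2 * Real.pi) (hk : 1 ≤ k) {x : ℝ} (hx : 0 < x) :
    (Gam (C lam * (X - 1) ^ k * X) ((X - 1) ^ k) (polar x (slope lam * x))).Nonempty := by
  rw [gam_nonempty_iff hre him h0 hg hk]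
  have h : polar x (slope lam * x) * Complex.exp (lam * (x / lam.re : ℝ)) = 1 := by
    rw [polar_mul_exp hre, mul_div_cancel₀ _ hre.ne', sub_self, sub_self, polar_zero]
  exact ⟨x / lam.re, by positivity, by rw [h]; exact (polar_ne_one hx).symm,
    by rw [h]; exact one_mem_spiralSet hre him h0 hg⟩

lemma del_circle_nonempty (hre : 0 < lam.re) (him : 0 < lam.im) (h0 : 0 < X₀)
    (hg : gap lam X₀ = 2 * Real.pi) (hk : 1 ≤ k) {x : ℝ} (hx : 0 < x) :
    (Del (C lam * (X - 1) ^ k * X) ((X - 1) ^ k) (polar x (lower lam x))).Nonempty := by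
  rw [del_nonempty_iff hre him h0 hg hk (polar_ne_zero _ _) (polar_ne_one hx)]
  have h : polar x (lower lam x) * (1 + lam * circleTime lam x) = 1 := by
    rw [polar_mul_line hre him hx.le, sub_self, sub_self, polar_zero]
  exact ⟨circleTime lam x, circleTime_nonneg hre him hx.le,
    by rw [h]; exact (polar_ne_one hx).symm,
    by rw [h]; exact one_mem_spiralSet hre him h0 hg⟩

lemma one_le_of_mul_two_pi_pos {n : ℤ} (h : 0 < (n : ℝ) * (2 * Real.pi)) : (1 : ℝ) ≤ n := by
  have h4 : (0 : ℝ) < n := by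
    by_contra h
    push Not at h
    nlinarith [Real.pi_pos]
  exact_mod_cast (by exact_mod_cast h4 : 0 < n)

lemma gap_lt_two_pi (hre : 0 < lam.re) (him : 0 < lam.im)
    (hg : gap lam X₀ = 2 * Real.pi) {x : ℝ} (hx : x ∈ Ico 0 X₀) : gap lam x < 2 * Real.pi := by
  rw [← hg]; exact strictMonoOn_gap hre him hx.1 (hx.1.trans hx.2.le) hx.2

/-- Moving along the ray by B lifts the point above the line by gap B > 0. To re-enter the band from
above after whole turns would require 2π ≤ gap B + gap (x - B) ≤ gap x, but gap x < 2π before X₀. -/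
lemma del_spiral_eq_empty (hre : 0 < lam.re) (him : 0 < lam.im) (h0 : 0 < X₀)
    (hg : gap lam X₀ = 2 * Real.pi) (hk : 1 ≤ k) {x : ℝ} (hx : x ∈ Ioo 0 X₀) :
    Del (C lam * (X - 1) ^ k * X) ((X - 1) ^ k) (polar x (slope lam * x)) = ∅ := by
  rw [← not_nonempty_iff_eq_empty,
    del_nonempty_iff hre him h0 hg hk (polar_ne_zero _ _) (polar_ne_one hx.1)]
  rintro ⟨t, ht, hne, hm⟩
  obtain ⟨B, hB, rfl⟩ := exists_circleTime hre him ht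
  have hB : 0 < B := hB.lt_of_ne (by rintro rfl; simp [circleTime_zero] at hne)
  rw [polar_mul_line hre him hB.le, polar_mem_spiralSet hre him h0 hg] at hm
  obtain ⟨hxB, n, h1, h2⟩ := hm
  have h3 := gap_add_le hre him hB.le hxB
  rw [add_sub_cancel] at h3
  have h4 := gap_pos hre him hB
  have h5 := gap_lt_two_pi hre him hg (Ioo_subset_Ico_self hx)
  have e1 := slope_mul_eq (lam := lam) B
  have e2 := slope_mul_eq (lam := lam) (x - B)
  rw [mul_sub] at e2 h2
  have h6 : (1 : ℝ) ≤ (-n : ℤ) := one_le_of_mul_two_pi_pos (by push_cast; linarith)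
  push_cast at h6
  nlinarith [Real.pi_pos]

/-- The flow keeps the distance gap x to the line, while the width of the band shrinks to gap (x -
D) < gap x, so the point falls below the band. Re-entering by n ≥ 1 turns would need 2πn ≤ gap x <
2π. -/
lemma gam_circle_eq_empty (hre : 0 < lam.re) (him : 0 < lam.im) (h0 : 0 < X₀)
    (hg : gap lam X₀ = 2 * Real.pi) (hk : 1 ≤ k) {x : ℝ} (hx : x ∈ Ioo 0 X₀) :
    Gam (C lam * (X - 1) ^ k * X) ((X - 1) ^ k) (polar x (lower lam x)) = ∅ := by
  rw [← not_nonempty_iff_eq_empty, gam_nonempty_iff hre him h0 hg hk]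
  rintro ⟨s, hs, hne, hm⟩
  have hs : 0 < s := hs.lt_of_ne (by rintro rfl; simp at hne)
  rw [polar_mul_exp hre, polar_mem_spiralSet hre him h0 hg] at hm
  have hD : 0 < lam.re * s := by positivity
  generalize lam.re * s = D at *
  obtain ⟨hxD, n, h1, h2⟩ := hm
  have h3 := strictMonoOn_gap hre him hxD hx.1.le (show x - D < x by linarith)
  have h5 := gap_lt_two_pi hre him hg (Ioo_subset_Ico_self hx)
  have e1 := slope_mul_eq (lam := lam) x
  have e2 := slope_mul_eq (lam := lam) (x - D)
  rw [mul_sub] at e2 h2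
  have h6 : (1 : ℝ) ≤ n := one_le_of_mul_two_pi_pos (by linarith)
  nlinarith [Real.pi_pos]

/-- The circle and the spiral meet at the radius `exp (-X)` exactly if the angle between them is a
multiple of `2π`. -/
lemma spiral_eq_circle_iff {x y : ℝ} :
    polar x (slope lam * x) = polar y (lower lam y) ↔
      x = y ∧ ∃ n : ℤ, gap lam y = n * (2 * Real.pi) := by
  rw [polar_eq_iff]
  refine and_congr_right fun h => exists_congr fun n => ?_
  rw [h, slope_mul_eq]
  constructor <;> intro h <;> linarith

/-- At a meeting point `gap` is a positive multiple of 2π, hence at least gap X₀, and `gap` is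
increasing. -/
lemma le_of_spiral_eq_circle (hre : 0 < lam.re) (him : 0 < lam.im) (h0 : 0 < X₀)
    (hg : gap lam X₀ = 2 * Real.pi) {x y : ℝ} (hy : 0 < y)
    (h : polar x (slope lam * x) = polar y (lower lam y)) : x = y ∧ X₀ ≤ y := by
  obtain ⟨rfl, n, hn⟩ := spiral_eq_circle_iff.1 h
  refine ⟨rfl, ?_⟩
  have h1 := gap_pos hre him hy
  have h2 := one_le_of_mul_two_pi_pos (hn ▸ h1)
  rw [← (strictMonoOn_gap hre him).le_iff_le h0.le hy.le, hg, hn]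
  nlinarith [Real.pi_pos]

lemma spiral_eq_circle_end (hg : gap lam X₀ = 2 * Real.pi) :
    polar X₀ (slope lam * X₀) = polar X₀ (lower lam X₀) :=
  spiral_eq_circle_iff.2 ⟨rfl, 1, by simpa using hg⟩

lemma mem_ordinaryBoundary_iff (hre : 0 < lam.re) (him : 0 < lam.im) (h0 : 0 < X₀)
    (hg : gap lam X₀ = 2 * Real.pi) (hk : 1 ≤ k) {z : ℂ} :
    z ∈ ordinaryBoundary (C lam * (X - 1) ^ k * X) ((X - 1) ^ k) ↔
      (∃ x ∈ Ioc 0 X₀, polar x (slope lam * x) = z) ∨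
        ∃ x ∈ Ioc 0 X₀, polar x (lower lam x) = z := by
  rw [ordinaryBoundary, minimalSet_eq hre him h0 hg hk, frontier_spiralSet hre him h0 hg,
    zeroSet_eq hre hk, inflectionCurve_eq him, union_empty]
  have hz : ∀ x Y, 0 < x → polar x Y ∉ ({0, 1} : Set ℂ) := by
    rintro x Y hx (h | h)
    · exact polar_ne_zero _ _ h
    · exact polar_ne_one hx h
  constructor
  · rintro ⟨⟨x, hx, rfl⟩ | ⟨x, hx, rfl⟩, hn⟩
    · refine Or.inl ⟨x, ⟨hx.1.lt_of_ne ?_, hx.2⟩, rfl⟩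
      rintro rfl
      simp [polar_zero] at hn
    · refine Or.inr ⟨x, ⟨hx.1.lt_of_ne ?_, hx.2⟩, rfl⟩
      rintro rfl
      simp [polar_zero, lower_zero] at hn
  · rintro (⟨x, hx, rfl⟩ | ⟨x, hx, rfl⟩)
    · exact ⟨Or.inl ⟨x, Ioc_subset_Icc_self hx, rfl⟩, hz _ _ hx.1⟩
    · exact ⟨Or.inr ⟨x, Ioc_subset_Icc_self hx, rfl⟩, hz _ _ hx.1⟩

/-- Points of the circle, including the common end point at X₀, see 1 along their ray, so their Δ is
nonempty and they are excluded. -/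
theorem localPoints_eq (hre : 0 < lam.re) (him : 0 < lam.im) (h0 : 0 < X₀)
    (hg : gap lam X₀ = 2 * Real.pi) (hk : 1 ≤ k) :
    localPoints (C lam * (X - 1) ^ k * X) ((X - 1) ^ k) =
      (fun x => polar x (slope lam * x)) '' Ioo 0 X₀ := by
  ext z
  constructor
  · rintro ⟨hz, -, hD⟩
    rcases (mem_ordinaryBoundary_iff hre him h0 hg hk).1 hz with ⟨x, hx, rfl⟩ | ⟨x, hx, rfl⟩
    · refine ⟨x, ⟨hx.1, hx.2.lt_of_ne ?_⟩, rfl⟩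
      rintro rfl
      rw [spiral_eq_circle_end hg] at hD
      exact (del_circle_nonempty hre him h0 hg hk hx.1).ne_empty hD
    · exact absurd hD (del_circle_nonempty hre him h0 hg hk hx.1).ne_empty
  · rintro ⟨x, hx, rfl⟩
    exact ⟨(mem_ordinaryBoundary_iff hre him h0 hg hk).2
      (Or.inl ⟨x, Ioo_subset_Ioc_self hx, rfl⟩),
      gam_spiral_nonempty hre him h0 hg hk hx.1, del_spiral_eq_empty hre him h0 hg hk hx⟩

theorem globalPoints_eq (hre : 0 < lam.re) (him : 0 < lam.im) (h0 : 0 < X₀)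
    (hg : gap lam X₀ = 2 * Real.pi) (hk : 1 ≤ k) :
    globalPoints (C lam * (X - 1) ^ k * X) ((X - 1) ^ k) =
      (fun x => polar x (lower lam x)) '' Ioo 0 X₀ := by
  ext z
  constructor
  · rintro ⟨hz, hG, -⟩
    rcases (mem_ordinaryBoundary_iff hre him h0 hg hk).1 hz with ⟨x, hx, rfl⟩ | ⟨x, hx, rfl⟩
    · exact absurd hG (gam_spiral_nonempty hre him h0 hg hk hx.1).ne_empty
    · refine ⟨x, ⟨hx.1, hx.2.lt_of_ne ?_⟩, rfl⟩
      rintro rfl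
      rw [← spiral_eq_circle_end hg] at hG
      exact (gam_spiral_nonempty hre him h0 hg hk hx.1).ne_empty hG
  · rintro ⟨x, hx, rfl⟩
    exact ⟨(mem_ordinaryBoundary_iff hre him h0 hg hk).2
      (Or.inr ⟨x, Ioo_subset_Ioc_self hx, rfl⟩),
      gam_circle_eq_empty hre him h0 hg hk hx, del_circle_nonempty hre him h0 hg hk hx.1⟩

theorem end_mem_extrudingPoints (hre : 0 < lam.re) (him : 0 < lam.im) (h0 : 0 < X₀)
    (hg : gap lam X₀ = 2 * Real.pi) (hk : 1 ≤ k) :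
    polar X₀ (slope lam * X₀) ∈
      extrudingPoints (C lam * (X - 1) ^ k * X) ((X - 1) ^ k) := by
  refine ⟨(mem_ordinaryBoundary_iff hre him h0 hg hk).2 (Or.inl ⟨X₀, ⟨h0, le_rfl⟩, rfl⟩),
    gam_spiral_nonempty hre him h0 hg hk h0, ?_⟩
  rw [spiral_eq_circle_end hg]
  exact del_circle_nonempty hre him h0 hg hk h0

/-! ### The arcs in their original parameters -/

lemma isOpenArc_circle (hre : 0 < lam.re) {t₁ : ℝ} (ht₁ : 0 < t₁) :
    IsOpenArc ((fun t : ℝ => 1 / (1 + lam * t)) '' Ioo 0 t₁) := by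
  have hl : lam ≠ 0 := fun h => by simp [h] at hre
  have hinv : ∀ t : ℝ, 0 < t → (((1 / (1 / (1 + lam * t)) - 1) / lam).re) = t := by
    intro t ht
    have := one_add_mul_ne_zero hre ht.le
    rw [one_div_one_div, add_sub_cancel_left, mul_div_cancel_left₀ _ hl, Complex.ofReal_re]
  -- The inverse recovers t as Re((1/z - 1)/λ), rescaled by t₁.
  have e : (fun t : ℝ => 1 / (1 + lam * t)) '' Ioo 0 t₁ ≃ₜ Ioo (0 : ℝ) 1 :=
    { toFun := fun z => ⟨((1 / (z : ℂ) - 1) / lam).re / t₁, by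
        obtain ⟨_, t, ht, rfl⟩ := z
        rw [hinv t ht.1]
        exact ⟨div_pos ht.1 ht₁, (div_lt_one ht₁).2 ht.2⟩⟩
      invFun := fun s => ⟨1 / (1 + lam * ((s * t₁ : ℝ) : ℂ)), (s : ℝ) * t₁,
        ⟨mul_pos s.2.1 ht₁, mul_lt_of_lt_one_left ht₁ s.2.2⟩, rfl⟩
      left_inv := by
        rintro ⟨_, t, ht, rfl⟩
        simp only [hinv t ht.1, div_mul_cancel₀ _ ht₁.ne']
      right_inv := by
        rintro ⟨s, hs⟩
        simp only [hinv (s * t₁) (mul_pos hs.1 ht₁), mul_div_cancel_right₀ _ ht₁.ne']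
      continuous_toFun := by
        refine Continuous.subtype_mk ((Complex.continuous_re.comp
          (((continuous_const.div continuous_subtype_val ?_).sub continuous_const).div_const
            lam)).div_const t₁) _
        rintro ⟨_, t, ht, rfl⟩
        exact one_div_ne_zero (one_add_mul_ne_zero hre ht.1.le)
      continuous_invFun := by
        refine Continuous.subtype_mk (continuous_const.div (by fun_prop) fun s => ?_) _
        exact one_add_mul_ne_zero hre (mul_nonneg s.2.1.le ht₁.le) }
  exact ⟨e⟩

lemma mem_Ioo_iff_circleTime (hre : 0 < lam.re) (him : 0 < lam.im) (h0 : 0 < X₀) {x : ℝ}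
    (hx : 0 ≤ x) : circleTime lam x ∈ Ioo 0 (circleTime lam X₀) ↔ x ∈ Ioo 0 X₀ := by
  have h := strictMonoOn_circleTime hre him
  have h1 := h.lt_iff_lt self_mem_Ici (show x ∈ Ici 0 from hx)
  rw [circleTime_zero] at h1
  rw [mem_Ioo, mem_Ioo, h1, h.lt_iff_lt hx h0.le]

lemma mem_Icc_iff_circleTime (hre : 0 < lam.re) (him : 0 < lam.im) (h0 : 0 < X₀) {x : ℝ}
    (hx : 0 ≤ x) : circleTime lam x ∈ Icc 0 (circleTime lam X₀) ↔ x ∈ Icc 0 X₀ := by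
  have h := strictMonoOn_circleTime hre him
  have h1 := h.le_iff_le self_mem_Ici (show x ∈ Ici 0 from hx)
  rw [circleTime_zero] at h1
  rw [mem_Icc, mem_Icc, h1, h.le_iff_le hx h0.le]

lemma image_circle (hre : 0 < lam.re) (him : 0 < lam.im) {S T : Set ℝ} (hS : S ⊆ Ici 0)
    (hT : T ⊆ Ici 0) (h : ∀ x, 0 ≤ x → (circleTime lam x ∈ T ↔ x ∈ S)) :
    (fun t : ℝ => 1 / (1 + lam * t)) '' T = (fun x => polar x (lower lam x)) '' S := by
  ext z
  constructor
  · rintro ⟨t, ht, rfl⟩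
    obtain ⟨x, hx, rfl⟩ := exists_circleTime hre him (hT ht)
    exact ⟨x, (h x hx).1 ht, (circle_eq_polar hre him hx).symm⟩
  · rintro ⟨x, hx, rfl⟩
    exact ⟨circleTime lam x, (h x (hS hx)).2 hx, circle_eq_polar hre him (hS hx)⟩

lemma image_spiral (hre : 0 < lam.re) {S T : Set ℝ} (h : ∀ s, s ∈ T ↔ lam.re * s ∈ S) :
    (fun s : ℝ => Complex.exp (-lam * s)) '' T = (fun x => polar x (slope lam * x)) '' S := by
  ext z
  constructor
  · rintro ⟨s, hs, rfl⟩
    exact ⟨lam.re * s, (h s).1 hs, (spiral_eq_polar hre s).symm⟩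
  · rintro ⟨x, hx, rfl⟩
    have hc : lam.re * (x / lam.re) = x := mul_div_cancel₀ _ hre.ne'
    refine ⟨x / lam.re, (h _).2 (by rwa [hc]), ?_⟩
    simp only [spiral_eq_polar hre, hc]

end

end Hutchinson.Spiral

/-! ### Assembly of the main theorem -/

theorem mainTheorem9 (k : ℕ) (hk : 1 ≤ k) (lam : ℂ) (hre : 0 < lam.re) (him : 0 < lam.im)
    (Q P : ℂ[X]) (hQ : Q = C lam * (X - 1) ^ k * X) (hP : P = (X - 1) ^ k)
    (γ α : ℝ → ℂ) (hγ : ∀ t, γ t = Complex.exp (-lam * t)) (hα : ∀ t, α t = 1 / (1 + lam * t)) :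
    IsLeast {S | Hutchinson.IsTCHInvariant Q P S} (Hutchinson.minimalSet Q P) ∧
    IsCompact (Hutchinson.minimalSet Q P) ∧
    ∃ t₀ t₁ : ℝ, 0 < t₀ ∧ 0 < t₁ ∧
      -- the first intersection point of the two curves for positive parameters
      γ t₀ = α t₁ ∧
      (∀ s t : ℝ, 0 < s → 0 < t → γ s = α t → t₀ ≤ s ∧ t₁ ≤ t) ∧
      -- the boundary, its two arcs, and their common end points
      frontier (Hutchinson.minimalSet Q P) = γ '' Icc 0 t₀ ∪ α '' Icc 0 t₁ ∧
      Hutchinson.IsLocalArc Q P (γ '' Ioo 0 t₀) ∧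
      Hutchinson.IsGlobalArc Q P (α '' Ioo 0 t₁) ∧
      γ '' Icc 0 t₀ ∩ α '' Icc 0 t₁ = {1, γ t₀} ∧
      γ t₀ ∈ Hutchinson.extrudingPoints Q P := by
  open Hutchinson.Spiral in
  obtain rfl : γ = _ := funext hγ
  obtain rfl : α = _ := funext hα
  subst hQ hP
  obtain ⟨X₀, h0, hg⟩ := exists_gap_eq_two_pi hre him
  have hmono := strictMonoOn_circleTime hre him
  have hpos : 0 < circleTime lam X₀ := by
    simpa [circleTime_zero] using hmono self_mem_Ici h0.le h0
  have hγ₀ : Complex.exp (-lam * (X₀ / lam.re : ℝ)) = polar X₀ (slope lam * X₀) := by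
    rw [spiral_eq_polar hre, mul_div_cancel₀ _ hre.ne']
  have hγc := image_spiral hre (T := Icc 0 (X₀ / lam.re)) (S := Icc 0 X₀) fun s => by
    rw [mem_Icc, mem_Icc, le_div_iff₀' hre, mul_nonneg_iff_of_pos_left hre]
  have hγo := image_spiral hre (T := Ioo 0 (X₀ / lam.re)) (S := Ioo 0 X₀) fun s => by
    rw [mem_Ioo, mem_Ioo, lt_div_iff₀' hre, mul_pos_iff_of_pos_left hre]
  have hαc := image_circle hre him Icc_subset_Ici_self Icc_subset_Ici_self
    fun x hx => mem_Icc_iff_circleTime hre him h0 hx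
  have hαo := image_circle hre him (fun x hx => hx.1.le) (fun x hx => hx.1.le)
    fun x hx => mem_Ioo_iff_circleTime hre him h0 hx
  -- Both times belong to the radius exp(-X₀): on the spiral |γ(s)| = exp(-s Re λ), and on the
  -- circle the time is `circleTime`.
  refine ⟨isLeast_minimalSet hre hk, ?_, X₀ / lam.re, circleTime lam X₀, div_pos h0 hre, hpos,
    ?_, ?_, ?_, ?_, ?_, ?_, ?_⟩
  · rw [minimalSet_eq hre him h0 hg hk]
    exact isCompact_spiralSet
  · simp only [hγ₀, circle_eq_polar hre him h0.le]
    exact spiral_eq_circle_end hg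
  · intro s t hs ht h
    obtain ⟨y, hy, rfl⟩ := exists_circleTime hre him ht.le
    have hy0 : 0 < y := hy.lt_of_ne (by rintro rfl; simp [circleTime_zero] at ht)
    simp only [spiral_eq_polar hre, circle_eq_polar hre him hy] at h
    obtain ⟨h1, h2⟩ := le_of_spiral_eq_circle hre him h0 hg hy0 h
    exact ⟨by rw [div_le_iff₀' hre, h1]; exact h2, hmono.monotoneOn h0.le hy h2⟩
  · rw [minimalSet_eq hre him h0 hg hk, frontier_spiralSet hre him h0 hg, hγc, hαc]
  · refine ⟨⟨isIntegralArc_spiral (div_pos h0 hre), ?_⟩, fun B hB _ => ?_⟩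
    · rw [hγo, localPoints_eq hre him h0 hg hk]
    -- Maximality is immediate: the arc is already the set of all local points. The global arc is
    -- treated in the same way.
    · rw [hγo, ← localPoints_eq hre him h0 hg hk]
      exact hB.2
  · refine ⟨⟨isOpenArc_circle hre hpos, ?_⟩, fun B hB _ => ?_⟩
    · rw [hαo, globalPoints_eq hre him h0 hg hk]
    · rw [hαo, ← globalPoints_eq hre him h0 hg hk]
      exact hB.2
  · simp only [hγc, hαc, hγ₀]
    apply subset_antisymm
    · rintro _ ⟨⟨x, hx, rfl⟩, y, hy, h⟩
      rcases hy.1.eq_or_lt with rfl | hy0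
      · exact Or.inl (by rw [← h]; simp [polar_zero, lower_zero])
      · obtain ⟨rfl, h1⟩ := le_of_spiral_eq_circle hre him h0 hg hy0 h.symm
        exact Or.inr (by simp [le_antisymm hx.2 h1])
    · rintro _ (rfl | rfl)
      · exact ⟨⟨0, ⟨le_rfl, h0.le⟩, by simp [polar_zero]⟩,
          0, ⟨le_rfl, h0.le⟩, by simp [polar_zero, lower_zero]⟩
      · exact ⟨⟨X₀, ⟨h0.le, le_rfl⟩, rfl⟩, X₀, ⟨h0.le, le_rfl⟩, (spiral_eq_circle_end hg).symm⟩
  · simp only [hγ₀]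
    exact end_mem_extrudingPoints hre him h0 hg hk
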